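/- Let $H$ be a separable (real or complex) Hilbert space and let $\mathcal{B}(H)$ be the space of bounded linear operators on $H$. Let $K\subset\mathcal{B}(H)$ be a non-empty set which is (i) separable in the operator norm topology, (ii) convex, and (iii) closed in the weak operator topology. Let $G$ be a subgroup of the group $\mathcal{U}(H)$ of unitary operators on $H$ (orthogonal operators, if $H$ is real) such that $gTg^{-1}\in K$ for every $g\in G$ and every $T\in K$. Then there is an operator $T_0\in K$ such that $gT_0g^{-1}=T_0$ for every $g\in G$. -/

import Mathlib

/-- The adjoint action of a unitary operator `u` on bounded operators: `T ↦ u T u⁻¹`. -/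
noncomputable def unitaryConj {𝕜 H : Type*} [RCLike 𝕜] [NormedAddCommGroup H] [InnerProductSpace 𝕜 H]
    [CompleteSpace H] (u : unitary (H →L[𝕜] H)) (T : H →L[𝕜] H) : H →L[𝕜] H :=
  (u : H →L[𝕜] H) ∘L T ∘L ((u⁻¹ : unitary (H →L[𝕜] H)) : H →L[𝕜] H)

/-- A set of bounded operators is closed in the weak operator topology. -/
def IsWOTClosed {𝕜 H : Type*} [RCLike 𝕜] [NormedAddCommGroup H] [InnerProductSpace 𝕜 H]
    (K : Set (H →L[𝕜] H)) : Prop :=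
  IsClosed ((fun T : H →WOT[𝕜] H => T.toCLM) ⁻¹' K)

/-! Cut `K` down to a ball: the result is WOT-compact, convex and invariant under `G`, which acts by
norm isometries. On it a weighted sum of squared matrix coefficients is WOT-continuous and strictly
midpoint-convex. Minimising its supremum over orbits gives an invariant set where every pair `x, y`
has translates of arbitrarily small convexity defect, so the orbit closure of `(x, y)` meets the
diagonal. In a minimal closed invariant subset, Baire and norm separability give a relatively open
piece of norm diameter at most `ε`. Some translate of `(x, y)` enters it, and invariance of the norm
gives `‖x - y‖ ≤ ε`. Hence the minimal set is a fixed point. -/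

open Set Topology

/-! ### Topological dynamics and the abstract fixed point theorem. -/

/-- In a compact space with a continuous group action, every nonempty closed invariant set contains
a nonempty closed invariant set all of whose points have dense orbits in it. -/
theorem exists_minimal_closed_invariant_subset {G X : Type*} [Group G] [MulAction G X]
    [TopologicalSpace X] [CompactSpace X] [ContinuousConstSMul G X] {F : Set X}
    (hF : IsClosed F) (hne : F.Nonempty) (hinv : ∀ g : G, ∀ x ∈ F, g • x ∈ F) :
    ∃ E ⊆ F, IsClosed E ∧ E.Nonempty ∧ (∀ g : G, ∀ x ∈ E, g • x ∈ E) ∧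
      ∀ x ∈ E, E ⊆ closure (MulAction.orbit G x) := by
  let S : Set (Set X) := {E | IsClosed E ∧ E.Nonempty ∧ ∀ g : G, ∀ x ∈ E, g • x ∈ E}
  obtain ⟨E, hEF, hE⟩ := zorn_superset_nonempty S (by
    intro c hcS hc hcne
    refine ⟨⋂₀ c, ⟨isClosed_sInter fun s hs => (hcS hs).1, ?_, ?_⟩, fun s hs => sInter_subset_of_mem hs⟩
    · have : Nonempty c := hcne.to_subtype
      exact IsCompact.nonempty_sInter_of_directed_nonempty_isCompact_isClosed
        (IsChain.directedOn hc.symm) (fun U hU => (hcS hU).2.1)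
        (fun U hU => (hcS hU).1.isCompact) (fun U hU => (hcS hU).1)
    · exact fun g x hx s hs => (hcS hs).2.2 g x (hx s hs)) F ⟨hF, hne, hinv⟩
  obtain ⟨hEc, hEne, hEinv⟩ := hE.prop
  refine ⟨E, hEF, hEc, hEne, hEinv, fun x hx => ?_⟩
  refine hE.le_of_le (y := closure (MulAction.orbit G x)) ⟨isClosed_closure,
    (MulAction.nonempty_orbit x).closure, fun g y hy => ?_⟩ ?_
  · exact smul_closure_orbit_subset g x (smul_mem_smul_set hy)
  · refine closure_minimal ?_ hEc
    rintro _ ⟨g, rfl⟩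
    exact hEinv g x hx

/-- If a continuous midpoint-convex function is given on a compact space with an affine group
action, then some nonempty closed invariant set has all its pairs of points asymptotically
indistinguishable by the convexity defect of that function. -/
theorem exists_closed_invariant_forall_exists_defect_lt {G X : Type*} [Group G] [MulAction G X]
    [TopologicalSpace X] [CompactSpace X] [Nonempty X] [ContinuousConstSMul G X]
    {m : X → X → X} (hmG : ∀ (g : G) x y, g • m x y = m (g • x) (g • y))
    {q : X → ℝ} (hq : Continuous q) :
    ∃ F : Set X, IsClosed F ∧ F.Nonempty ∧ (∀ g : G, ∀ x ∈ F, g • x ∈ F) ∧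
      ∀ x ∈ F, ∀ y ∈ F, ∀ δ > 0, ∃ g : G,
        (q (g • x) + q (g • y)) / 2 - q (m (g • x) (g • y)) < δ := by
  let Φ : X → ℝ := fun z => ⨆ g : G, q (g • z)
  have hbdd : ∀ z, BddAbove (range fun g : G => q (g • z)) := fun z =>
    (isCompact_range hq).bddAbove.mono (by rintro _ ⟨g, rfl⟩; exact mem_range_self _)
  have hΦ : LowerSemicontinuous Φ := lowerSemicontinuous_ciSup hbdd fun g =>
    (hq.comp (continuous_const_smul g)).lowerSemicontinuous
  obtain ⟨z₀, -, hz₀⟩ := LowerSemicontinuousOn.exists_isMinOn (univ_nonempty (α := X))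
    isCompact_univ (hΦ.lowerSemicontinuousOn univ)
  refine ⟨{z | Φ z ≤ Φ z₀}, hΦ.isClosed_preimage (Φ z₀), ⟨z₀, le_refl (Φ z₀)⟩, fun g x hx => ?_,
    fun x hx y hy δ hδ => ?_⟩
  · refine (ciSup_le fun h => ?_).trans (show Φ x ≤ Φ z₀ from hx)
    rw [← mul_smul]
    exact le_ciSup (hbdd x) (h * g)
  -- Minimality of `Φ z₀` makes some translate of the midpoint have `q` above `Φ z₀ - δ`, while both
  -- translated endpoints stay at most `Φ z₀`.
  · have hz : Φ z₀ - δ < Φ (m x y) := by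
      have : Φ z₀ ≤ Φ (m x y) := hz₀ (mem_univ _)
      linarith
    obtain ⟨g, hg⟩ := exists_lt_of_lt_ciSup hz
    have h1 : q (g • x) ≤ Φ z₀ := (le_ciSup (hbdd x) g).trans (show Φ x ≤ Φ z₀ from hx)
    have h2 : q (g • y) ≤ Φ z₀ := (le_ciSup (hbdd y) g).trans (show Φ y ≤ Φ z₀ from hy)
    refine ⟨g, ?_⟩
    rw [← hmG]
    linarith

/-- A fixed point theorem of Ryll-Nardzewski type: a group acting affinely on a compact space that
carries a strictly midpoint-convex continuous function, and leaving invariant a distance `d` for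
which the space is covered by countably many closed sets of small diameter, has a fixed point. -/
theorem exists_forall_smul_eq_of_strict_midpoint_convex {G X : Type*} [Group G] [MulAction G X]
    [TopologicalSpace X] [CompactSpace X] [T2Space X] [Nonempty X] [ContinuousConstSMul G X]
    {m : X → X → X} (hm : Continuous fun p : X × X => m p.1 p.2)
    (hmG : ∀ (g : G) x y, g • m x y = m (g • x) (g • y))
    {q : X → ℝ} (hq : Continuous q) (hqm : ∀ x y, x ≠ y → q (m x y) < (q x + q y) / 2)
    {d : X → X → ℝ} (hdG : ∀ (g : G) x y, d (g • x) (g • y) = d x y)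
    (hd : ∀ x y, (∀ ε > 0, d x y ≤ ε) → x = y)
    (hcov : ∀ ε > 0, ∃ A : ℕ → Set X, (∀ n, IsClosed (A n)) ∧ ⋃ n, A n = univ ∧
      ∀ n, ∀ x ∈ A n, ∀ y ∈ A n, d x y ≤ ε) :
    ∃ x : X, ∀ g : G, g • x = x := by
  obtain ⟨F, hFc, hFne, hFinv, hF⟩ :=
    exists_closed_invariant_forall_exists_defect_lt (G := G) hmG hq
  obtain ⟨E, hEF, hEc, ⟨x₀, hx₀⟩, hEinv, hE⟩ :=
    exists_minimal_closed_invariant_subset hFc hFne hFinv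
  suffices hsub : ∀ x ∈ E, ∀ y ∈ E, x = y from
    ⟨x₀, fun g => hsub _ (hEinv g x₀ hx₀) _ hx₀⟩
  intro x hx y hy
  refine hd x y fun ε hε => ?_
  obtain ⟨A, hAc, hAU, hAd⟩ := hcov ε hε
  -- Baire category in the compact Hausdorff space `E`: one of the countably many closed pieces has
  -- interior.
  obtain ⟨n, W, hWo, ⟨w, hwE, hwW⟩, hWA⟩ :
      ∃ n, ∃ W : Set X, IsOpen W ∧ (E ∩ W).Nonempty ∧ E ∩ W ⊆ A n := by
    have : CompactSpace E := isCompact_iff_compactSpace.1 hEc.isCompact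
    have : Nonempty E := ⟨⟨x₀, hx₀⟩⟩
    obtain ⟨n, w, hw⟩ := nonempty_interior_of_iUnion_of_closed
      (f := fun n => ((↑) : E → X) ⁻¹' A n) (fun n => (hAc n).preimage continuous_subtype_val)
      (by rw [← preimage_iUnion, hAU, preimage_univ])
    obtain ⟨W, hWo, hW⟩ := isOpen_induced_iff.1
      (isOpen_interior (s := ((↑) : E → X) ⁻¹' A n))
    refine ⟨n, W, hWo, ⟨w, w.2, ?_⟩, fun u hu => ?_⟩
    · rw [← hW] at hw
      exact hw
    · have : (⟨u, hu.1⟩ : E) ∈ ((↑) : E → X) ⁻¹' W := hu.2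
      rw [hW] at this
      exact interior_subset (s := ((↑) : E → X) ⁻¹' A n) this
  let P : Set (X × X) := closure (range fun g : G => (g • x, g • y))
  have hdef : Continuous fun p : X × X => (q p.1 + q p.2) / 2 - q (m p.1 p.2) := by
    have := hq.comp hm
    fun_prop
  obtain ⟨⟨a, b⟩, hab, hmin⟩ := (isClosed_closure.isCompact : IsCompact P).exists_isMinOn
    (range_nonempty _).closure hdef.continuousOn
  -- Off the diagonal the minimal defect would be positive, yet some orbit pair has a smaller one.
  have hab' : a = b := by
    by_contra hne
    obtain ⟨g, hg⟩ := hF x (hEF hx) y (hEF hy) _ (sub_pos.2 (hqm a b hne))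
    exact absurd (hmin (subset_closure ⟨g, rfl⟩)) (not_le.2 hg)
  subst hab'
  have haE : a ∈ E := by
    have : P ⊆ Prod.fst ⁻¹' E := closure_minimal
      (by rintro _ ⟨g, rfl⟩; exact hEinv g x hx) (hEc.preimage continuous_fst)
    exact this hab
  -- Minimality moves `a` into `W` by some `h`; by continuity `h` also moves into `W × W` an orbit
  -- pair near `(a, a)`.
  obtain ⟨_, haW, h, rfl⟩ := mem_closure_iff.1 (hE a haE hwE) W hWo hwW
  have hU : IsOpen {p : X × X | h • p.1 ∈ W ∧ h • p.2 ∈ W} :=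
    (hWo.preimage (continuous_fst.const_smul h)).inter
      (hWo.preimage (continuous_snd.const_smul h))
  obtain ⟨_, ⟨h1, h2⟩, g, rfl⟩ := mem_closure_iff.1 hab _ hU ⟨haW, haW⟩
  rw [← hdG g x y, ← hdG h]
  exact hAd n _ (hWA ⟨hEinv _ _ (hEinv _ _ hx), h1⟩) _ (hWA ⟨hEinv _ _ (hEinv _ _ hy), h2⟩)

/-! ### Weak operator topology: compact balls and a strictly convex function. -/

open Filter in
/-- Norm-closed balls are compact in the weak operator topology. -/
theorem isCompact_toCLM_preimage_closedBall {𝕜 H : Type*} [RCLike 𝕜] [NormedAddCommGroup H]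
    [InnerProductSpace 𝕜 H] [CompleteSpace H] (R : ℝ) :
    IsCompact ((fun T : H →WOT[𝕜] H => T.toCLM) ⁻¹' Metric.closedBall 0 R) := by
  rw [isCompact_iff_ultrafilter_le_nhds]
  intro U hU
  have hU' : ∀ᶠ T : H →WOT[𝕜] H in U, ‖T.toCLM‖ ≤ R := by
    filter_upwards [le_principal_iff.1 hU] with T hT
    simpa using hT
  have hbd : ∀ (T : H →WOT[𝕜] H), ‖T.toCLM‖ ≤ R → ∀ v w : H,
      ‖inner 𝕜 (T v) w‖ ≤ R * ‖v‖ * ‖w‖ := fun T hT v w =>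
    (norm_inner_le_norm _ _).trans
      (mul_le_mul_of_nonneg_right (T.toCLM.le_of_opNorm_le hT v) (norm_nonneg _))
  have hlim : ∀ v w : H, ∃ b : 𝕜, Tendsto (fun T : H →WOT[𝕜] H => inner 𝕜 (T v) w) U (𝓝 b) := by
    intro v w
    obtain ⟨b, -, hb⟩ := (isCompact_closedBall (0 : 𝕜) (R * ‖v‖ * ‖w‖)).ultrafilter_le_nhds
      (U.map fun T => inner 𝕜 (T v) w) (by
        rw [le_principal_iff, Ultrafilter.mem_coe, Ultrafilter.mem_map, ← Ultrafilter.mem_coe]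
        filter_upwards [hU'] with T hT
        simpa using hbd T hT v w)
    exact ⟨b, hb⟩
  choose b hb using hlim
  have hbR : ∀ v w, ‖b v w‖ ≤ R * ‖v‖ * ‖w‖ := fun v w =>
    le_of_tendsto (hb v w).norm (hU'.mono fun T hT => hbd T hT v w)
  let B : H →L⋆[𝕜] H →L[𝕜] 𝕜 := LinearMap.mkContinuous₂
    (LinearMap.mk₂'ₛₗ (starRingEnd 𝕜) (RingHom.id 𝕜) b
      (fun v₁ v₂ w => tendsto_nhds_unique (hb (v₁ + v₂) w) <| by
        simpa [inner_add_left] using (hb v₁ w).add (hb v₂ w))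
      (fun c v w => tendsto_nhds_unique (hb (c • v) w) <| by
        simpa [inner_smul_left] using (hb v w).const_mul (starRingEnd 𝕜 c))
      (fun v w₁ w₂ => tendsto_nhds_unique (hb v (w₁ + w₂)) <| by
        simpa [inner_add_right] using (hb v w₁).add (hb v w₂))
      (fun c v w => tendsto_nhds_unique (hb v (c • w)) <| by
        simpa [inner_smul_right] using (hb v w).const_mul c)) R hbR
  have hB : ∀ v w, inner 𝕜 (InnerProductSpace.continuousLinearMapOfBilin B v) w = b v w :=
    fun v w => InnerProductSpace.continuousLinearMapOfBilin_apply B v w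
  have hR : 0 ≤ R := by
    obtain ⟨T, hT⟩ := hU'.exists
    exact (norm_nonneg _).trans hT
  refine ⟨.ofCLM (InnerProductSpace.continuousLinearMapOfBilin B), ?_, ?_⟩
  · rw [mem_preimage, mem_closedBall_zero_iff]
    refine ContinuousLinearMap.opNorm_le_of_re_inner_le hR fun v w hv hw => ?_
    refine (RCLike.re_le_norm _).trans ?_
    have := hbR v w
    rw [← hB, hv, hw, mul_one, mul_one] at this
    exact this
  · rw [ContinuousLinearMapWOT.le_nhds_iff_forall_inner_apply_le_nhds]
    intro v w
    -- The convergence criterion pairs with the operator in the second slot, hence the conjugate.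
    have h := (RCLike.continuous_conj.tendsto _).comp (hb v w)
    rw [← hB, inner_conj_symm] at h
    refine Tendsto.congr (fun T => ?_) h
    exact inner_conj_symm _ _

/-- On a norm-bounded set of operators on a separable Hilbert space, there is a WOT-continuous
strictly midpoint-convex function. -/
theorem exists_continuousOn_strict_midpoint_convex {𝕜 H : Type*} [RCLike 𝕜]
    [NormedAddCommGroup H] [InnerProductSpace 𝕜 H] [CompleteSpace H]
    [TopologicalSpace.SeparableSpace H] (R : ℝ) :
    ∃ q : (H →WOT[𝕜] H) → ℝ,
      ContinuousOn q ((fun T : H →WOT[𝕜] H => T.toCLM) ⁻¹' Metric.closedBall 0 R) ∧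
      ∀ S T, S ≠ T → q ((2⁻¹ : 𝕜) • (S + T)) < (q S + q T) / 2 := by
  let a : ℕ → H × H := TopologicalSpace.denseSeq (H × H)
  let c : ℕ → ℝ := fun k => (1 + ‖(a k).1‖ * ‖(a k).2‖)⁻¹
  have hc : ∀ k, 0 < c k := fun k => by positivity
  -- The factor `c k` bounds the normalised coefficient by `‖T‖`, so the geometric weights give
  -- uniform convergence on balls.
  let f : ℕ → (H →WOT[𝕜] H) → ℝ := fun k T =>
    (1 / 2 : ℝ) ^ k * (c k * ‖inner 𝕜 (a k).2 (T (a k).1)‖) ^ 2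
  have hf0 : ∀ k T, 0 ≤ f k T := fun k T => by positivity
  have hf : ∀ k T, f k T ≤ (1 / 2 : ℝ) ^ k * ‖T.toCLM‖ ^ 2 := by
    intro k T
    have h1 : ‖inner 𝕜 (a k).2 (T (a k).1)‖ ≤ ‖T.toCLM‖ * (1 + ‖(a k).1‖ * ‖(a k).2‖) := by
      have h2 := norm_inner_le_norm (𝕜 := 𝕜) (a k).2 (T (a k).1)
      have h3 := mul_le_mul_of_nonneg_left (T.toCLM.le_opNorm (a k).1) (norm_nonneg (a k).2)
      rw [ContinuousLinearMapWOT.toCLM_apply] at h3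
      nlinarith [norm_nonneg T.toCLM]
    have h4 : c k * ‖inner 𝕜 (a k).2 (T (a k).1)‖ ≤ ‖T.toCLM‖ := by
      rw [mul_comm]
      exact mul_inv_le_of_le_mul₀ (by positivity) (norm_nonneg _) h1
    exact mul_le_mul_of_nonneg_left
      (pow_le_pow_left₀ (mul_nonneg (hc k).le (norm_nonneg _)) h4 2) (by positivity)
  have hgeom : ∀ r : ℝ, Summable fun k : ℕ => (1 / 2 : ℝ) ^ k * r := fun r =>
    summable_geometric_two.mul_right r
  have hsum : ∀ T, Summable fun k => f k T := fun T =>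
    Summable.of_nonneg_of_le (fun k => hf0 k T) (fun k => hf k T) (hgeom _)
  refine ⟨fun T => ∑' k, f k T, ?_, fun S T hST => ?_⟩
  · refine continuousOn_tsum (u := fun k => (1 / 2 : ℝ) ^ k * R ^ 2) (fun k => ?_) (hgeom _) ?_
    · have : Continuous fun T : H →WOT[𝕜] H => inner 𝕜 (a k).2 (T (a k).1) :=
        ContinuousLinearMapWOT.continuous_iff.1 continuous_id _ _
      exact Continuous.continuousOn (by fun_prop)
    · intro k T hT
      rw [mem_preimage, mem_closedBall_zero_iff] at hT
      rw [Real.norm_of_nonneg (hf0 k T)]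
      refine (hf k T).trans ?_
      gcongr
  -- By the parallelogram law the defect of each term is exactly `f k (S - T) / 4`; density makes
  -- one of them positive.
  have hpar : ∀ k, f k ((2⁻¹ : 𝕜) • (S + T)) + f k (S - T) / 4 = (f k S + f k T) / 2 := by
    intro k
    have := parallelogram_law_with_norm 𝕜 (inner 𝕜 (a k).2 (S (a k).1) : 𝕜)
      (inner 𝕜 (a k).2 (T (a k).1))
    have h2 : ‖(2⁻¹ : 𝕜)‖ = 2⁻¹ := by simp
    simp only [f, ContinuousLinearMapWOT.smul_apply, ContinuousLinearMapWOT.add_apply,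
      ContinuousLinearMapWOT.sub_apply, inner_smul_right, inner_add_right, inner_sub_right,
      norm_mul, h2]
    linear_combination ((1 / 2 : ℝ) ^ k * c k ^ 2 / 4) * this
  obtain ⟨k, hk⟩ : ∃ k, 0 < f k (S - T) := by
    by_contra! hcon
    refine hST (sub_eq_zero.1 (ContinuousLinearMapWOT.ext_inner fun x y => ?_))
    have hcl : IsClosed {p : H × H | inner 𝕜 p.2 ((S - T) p.1) = 0} := by
      have : Continuous fun v => (S - T) v := (S - T).toCLM.continuous
      exact isClosed_eq (by fun_prop) continuous_const
    have : (univ : Set (H × H)) ⊆ {p : H × H | inner 𝕜 p.2 ((S - T) p.1) = 0} := by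
      rw [← (TopologicalSpace.denseRange_denseSeq (H × H)).closure_range]
      refine closure_minimal ?_ hcl
      rintro _ ⟨k, rfl⟩
      have h0 : f k (S - T) = 0 := le_antisymm (hcon k) (hf0 k _)
      simpa [f, (hc k).ne'] using h0
    simpa using this (mem_univ (x, y))
  calc ∑' k, f k ((2⁻¹ : 𝕜) • (S + T)) < ∑' k, (f k S + f k T) / 2 := by
        refine Summable.tsum_lt_tsum (i := k) (fun j => ?_) ?_ (hsum _)
          (((hsum S).add (hsum T)).div_const 2)
        · have := hpar j
          have := hf0 j (S - T)
          linarith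
        · have := hpar k
          linarith
    _ = (∑' k, f k S + ∑' k, f k T) / 2 := by
        rw [tsum_div_const, (hsum S).tsum_add (hsum T)]

/-! ### Conjugation by unitaries, and the main theorem. -/

section UnitaryConj

variable {𝕜 H : Type*} [RCLike 𝕜] [NormedAddCommGroup H] [InnerProductSpace 𝕜 H] [CompleteSpace H]

theorem unitaryConj_eq_mul (u : unitary (H →L[𝕜] H)) (T : H →L[𝕜] H) :
    unitaryConj u T = u * (T * (u⁻¹ : unitary (H →L[𝕜] H))) := rfl

theorem unitaryConj_one (T : H →L[𝕜] H) : unitaryConj 1 T = T := by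
  simp [unitaryConj_eq_mul]

theorem unitaryConj_mul (u v : unitary (H →L[𝕜] H)) (T : H →L[𝕜] H) :
    unitaryConj (u * v) T = unitaryConj u (unitaryConj v T) := by
  simp only [unitaryConj_eq_mul, mul_inv_rev, Submonoid.coe_mul, mul_assoc]

theorem unitaryConj_add (u : unitary (H →L[𝕜] H)) (S T : H →L[𝕜] H) :
    unitaryConj u (S + T) = unitaryConj u S + unitaryConj u T := by
  simp only [unitaryConj_eq_mul, add_mul, mul_add]

theorem unitaryConj_sub (u : unitary (H →L[𝕜] H)) (S T : H →L[𝕜] H) :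
    unitaryConj u (S - T) = unitaryConj u S - unitaryConj u T := by
  simp only [unitaryConj_eq_mul, sub_mul, mul_sub]

theorem unitaryConj_smul (u : unitary (H →L[𝕜] H)) (c : 𝕜) (T : H →L[𝕜] H) :
    unitaryConj u (c • T) = c • unitaryConj u T := by
  simp only [unitaryConj_eq_mul, smul_mul_assoc, mul_smul_comm]

theorem norm_unitaryConj (u : unitary (H →L[𝕜] H)) (T : H →L[𝕜] H) :
    ‖unitaryConj u T‖ = ‖T‖ := by
  rw [unitaryConj_eq_mul, CStarRing.norm_coe_unitary_mul, CStarRing.norm_mul_coe_unitary]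

theorem continuous_unitaryConj_wot (u : unitary (H →L[𝕜] H)) :
    Continuous fun T : H →WOT[𝕜] H =>
      ContinuousLinearMapWOT.ofCLM (unitaryConj u T.toCLM) :=
  (ContinuousLinearMapWOT.continuous_postcomp (.ofCLM (u : H →L[𝕜] H))).comp
    (ContinuousLinearMapWOT.continuous_precomp
      (.ofCLM ((u⁻¹ : unitary (H →L[𝕜] H)) : H →L[𝕜] H)))

/-- Compact sets are closed in a Hausdorff topology. This turns a countable cover by norm balls into
one by WOT-closed sets, as Baire requires. -/
theorem isClosed_setOf_norm_toCLM_sub_le (S : H →L[𝕜] H) (r : ℝ) :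
    IsClosed {T : H →WOT[𝕜] H | ‖T.toCLM - S‖ ≤ r} := by
  have h := (isCompact_toCLM_preimage_closedBall (𝕜 := 𝕜) (H := H) r).isClosed.preimage
    (continuous_id.sub (continuous_const (y := ContinuousLinearMapWOT.ofCLM S)))
  convert h using 1
  ext T
  simp

end UnitaryConj

/-- The real scalar structure on `H`, used only to speak of convexity, is the one induced by the
scalar field `𝕜` (which is `ℝ` or `ℂ`). -/
theorem theorem1p4 {𝕜 H : Type*} [RCLike 𝕜] [NormedAddCommGroup H] [InnerProductSpace 𝕜 H]
    [CompleteSpace H] [NormedSpace ℝ H] [IsScalarTower ℝ 𝕜 H]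
    [TopologicalSpace.SeparableSpace H]
    (K : Set (H →L[𝕜] H)) (hne : K.Nonempty)
    (hsep : TopologicalSpace.IsSeparable K)
    (hconv : Convex ℝ K)
    (hclosed : IsWOTClosed K)
    (G : Subgroup (unitary (H →L[𝕜] H)))
    (hinv : ∀ g ∈ G, ∀ T ∈ K, unitaryConj g T ∈ K) :
    ∃ T₀ ∈ K, ∀ g ∈ G, unitaryConj g T₀ = T₀ := by
  obtain ⟨T₁, hT₁⟩ := hne
  let B : Set (H →WOT[𝕜] H) := (fun T => T.toCLM) ⁻¹' Metric.closedBall 0 ‖T₁‖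
  let X := {T : H →WOT[𝕜] H // T.toCLM ∈ K ∧ ‖T.toCLM‖ ≤ ‖T₁‖}
  have hXB : ∀ x : X, x.1 ∈ B := fun x => mem_closedBall_zero_iff.2 x.2.2
  have : CompactSpace X := by
    have h : IsCompact {T : H →WOT[𝕜] H | T.toCLM ∈ K ∧ ‖T.toCLM‖ ≤ ‖T₁‖} := by
      convert (isCompact_toCLM_preimage_closedBall (𝕜 := 𝕜) (H := H) ‖T₁‖).inter_left hclosed
        using 1
      ext T
      simp
    exact isCompact_iff_compactSpace.1 h
  have : Nonempty X := ⟨⟨.ofCLM T₁, hT₁, le_rfl⟩⟩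
  let _ : MulAction G X :=
    { smul := fun g x => ⟨.ofCLM (unitaryConj g x.1.toCLM), hinv g g.2 _ x.2.1,
        (norm_unitaryConj _ _).trans_le x.2.2⟩
      one_smul := fun x => Subtype.ext (congrArg ContinuousLinearMapWOT.ofCLM (unitaryConj_one x.1.toCLM))
      mul_smul := fun g h x => Subtype.ext
        (congrArg ContinuousLinearMapWOT.ofCLM (unitaryConj_mul _ _ x.1.toCLM)) }
  have hsmul : ∀ (g : G) (x : X), (g • x).1.toCLM = unitaryConj g x.1.toCLM := fun _ _ => rfl
  have : ContinuousConstSMul G X := ⟨fun g => Continuous.subtype_mk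
    ((continuous_unitaryConj_wot (g : unitary (H →L[𝕜] H))).comp continuous_subtype_val) _⟩
  have hmid : ∀ S ∈ K, ∀ T ∈ K, (2⁻¹ : 𝕜) • (S + T) ∈ K := by
    intro S hS T hT
    convert hconv hS hT (a := 2⁻¹) (b := 2⁻¹) (by norm_num) (by norm_num) (by norm_num) using 1
    ext v
    have h : ∀ w : H, (2⁻¹ : ℝ) • w = (2⁻¹ : 𝕜) • w := fun w => by
      rw [RCLike.real_smul_eq_coe_smul (K := 𝕜), RCLike.ofReal_inv, RCLike.ofReal_ofNat]
    simp [h]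
  let m : X → X → X := fun x y => ⟨(2⁻¹ : 𝕜) • (x.1 + y.1), hmid _ x.2.1 _ y.2.1, by
    rw [ContinuousLinearMapWOT.toCLM_smul, ContinuousLinearMapWOT.toCLM_add, norm_smul]
    have h1 := norm_add_le x.1.toCLM y.1.toCLM
    have h2 : ‖(2⁻¹ : 𝕜)‖ = 2⁻¹ := by simp
    rw [h2]
    linarith [x.2.2, y.2.2]⟩
  have hm : Continuous fun p : X × X => m p.1 p.2 := by
    have h1 : Continuous fun p : X × X => p.1.1 := continuous_subtype_val.comp continuous_fst
    have h2 : Continuous fun p : X × X => p.2.1 := continuous_subtype_val.comp continuous_snd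
    exact ((h1.add h2).const_smul (2⁻¹ : 𝕜)).subtype_mk _
  obtain ⟨q, hq, hqm⟩ := exists_continuousOn_strict_midpoint_convex (𝕜 := 𝕜) (H := H) ‖T₁‖
  obtain ⟨c, hc⟩ : ∃ c : ℕ → H →L[𝕜] H, K ⊆ closure (range c) := by
    obtain ⟨s, hs, hKs⟩ := hsep
    obtain ⟨c, rfl⟩ := hs.exists_eq_range (closure_nonempty_iff.1 ⟨T₁, hKs hT₁⟩)
    exact ⟨c, hKs⟩
  obtain ⟨x, hx⟩ := exists_forall_smul_eq_of_strict_midpoint_convex (G := G) (X := X)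
    (m := m) (q := fun x : X => q x.1) (d := fun x y : X => ‖x.1.toCLM - y.1.toCLM‖)
    hm
    (fun g x y => Subtype.ext (ContinuousLinearMapWOT.toCLM_injective (by
      change unitaryConj (g : unitary (H →L[𝕜] H)) ((2⁻¹ : 𝕜) • (x.1.toCLM + y.1.toCLM)) = _
      rw [unitaryConj_smul, unitaryConj_add]
      rfl)))
    (hq.comp_continuous continuous_subtype_val hXB)
    (fun x y hxy => hqm _ _ (Subtype.coe_injective.ne hxy))
    (fun g x y => by rw [hsmul, hsmul, ← unitaryConj_sub, norm_unitaryConj])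
    (fun x y h => Subtype.ext (ContinuousLinearMapWOT.toCLM_injective (sub_eq_zero.1
      (norm_le_zero_iff.1 (le_of_forall_pos_le_add fun ε hε => by simpa using h ε hε)))))
    (fun ε hε => ⟨fun n => {x : X | ‖x.1.toCLM - c n‖ ≤ ε / 2},
      fun n => (isClosed_setOf_norm_toCLM_sub_le (c n) _).preimage continuous_subtype_val, by
        refine iUnion_eq_univ_iff.2 fun x => ?_
        obtain ⟨_, ⟨n, rfl⟩, hn⟩ := Metric.mem_closure_iff.1 (hc x.2.1) (ε / 2) (half_pos hε)
        rw [dist_eq_norm] at hn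
        exact ⟨n, hn.le⟩, fun n x hx y hy => by
        have := norm_sub_le_norm_sub_add_norm_sub x.1.toCLM (c n) y.1.toCLM
        rw [norm_sub_rev (c n)] at this
        exact this.trans ((add_le_add hx hy).trans_eq (add_halves ε))⟩)
  exact ⟨x.1.toCLM, x.2.1, fun g hg => congrArg (fun y : X => y.1.toCLM) (hx ⟨g, hg⟩)⟩
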